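/- Let $k$ be an algebraically closed field of characteristic $p>0$ and let $H$ be a linear algebraic group over $k$ (an affine group scheme whose coordinate ring $k[H]$ is a finitely generated reduced $k$-algebra), with Lie algebra $\mathfrak h$ and $[p]$-map $X\mapsto X^{[p]}$. Let $\mathcal N_1(\mathfrak h)=\{X\in\mathfrak h : X^{[p]}=0\}$, and for $r\ge 1$ let $\mathcal C_r(\mathcal N_1(\mathfrak h))$ be the set of $r$-tuples $(X_0,\dots,X_{r-1})$ of elements of $\mathcal N_1(\mathfrak h)$ with $[X_i,X_j]=0$ for all $i,j$. Let $\mathbb G_a=\operatorname{Spec} k[t]$ be the additive group, let $\mathbb G_{a(r)}=\operatorname{Spec} k[t]/(t^{p^r})$ be its $r$-th Frobenius kernel, and let $\mathrm{Hom}_{grp/k}(\mathbb G_{a(r)},H)$ be the set of homomorphisms of group schemes over $k$. An exponential map for $H$ is an injective map $\mathcal E:\mathcal N_1(\mathfrak h)\to H(k)$, equivariant for the adjoint action of $H(k)$ on $\mathcal N_1(\mathfrak h)$ and conjugation on $H(k)$, such that for every $X\in\mathcal N_1(\mathfrak h)$: 1. the map $\mathcal E_X : s\mapsto \mathcal E(sX)$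 is a homomorphism of algebraic groups $\mathbb G_a\to H$ whose differential sends the tangent vector $\frac{d}{dt}\big|_{t=0}$ to $X$; 2. $\mathcal E(sX)$ acts trivially under the adjoint action on the centralizer $C_{\mathfrak h}(X)=\{Y\in\mathfrak h : [X,Y]=0\}$, for every $s\in k$. Theorem. Let $\mathcal E$ be an exponential map for $H$ and let $r\ge1$. For every $(X_0,\dots,X_{r-1})\in\mathcal C_r(\mathcal N_1(\mathfrak h))$ the map $$s\longmapsto \mathcal E(sX_0)\,\mathcal E(s^pX_1)\cdots\mathcal E(s^{p^{r-1}}X_{r-1})$$ is a homomorphism of algebraic groups $\mathbb G_a\to H$, and the map $$\mathcal E_*:\mathcal C_r(\mathcal N_1(\mathfrak h))\longrightarrow \mathrm{Hom}_{grp/k}(\mathbb G_{a(r)},H)$$ that sends $(X_0,\dots,X_{r-1})$ to the restriction of this homomorphism to $\mathbb G_{a(r)}$ is a bijection. -/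

import Mathlib

open scoped TensorProduct Polynomial
open WithConv

noncomputable section

namespace ExpGroup

/-! ### The additive group and its Frobenius kernels -/

section AdditiveGroup

variable (k : Type*) [CommRing k]

/-- The coordinate ring `k[t]` of the additive group `𝔾ₐ`, with `Δ(t) = t ⊗ 1 + 1 ⊗ t` and
`ε(t) = 0`. -/
instance gaBialgebra : Bialgebra k k[X] :=
  Bialgebra.ofAlgHom
    (Polynomial.aeval (Polynomial.X ⊗ₜ[k] (1 : k[X]) + (1 : k[X]) ⊗ₜ[k] Polynomial.X))
    (Polynomial.aeval 0)
    (by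
      ext
      simp [Algebra.TensorProduct.one_def, TensorProduct.add_tmul, TensorProduct.tmul_add]
      abel)
    (by ext; simp)
    (by ext; simp)

theorem ga_comul_X : Coalgebra.comul (R := k) (Polynomial.X : k[X]) =
    Polynomial.X ⊗ₜ[k] (1 : k[X]) + (1 : k[X]) ⊗ₜ[k] Polynomial.X :=
  Polynomial.aeval_X _

theorem ga_counit_X : Coalgebra.counit (R := k) (Polynomial.X : k[X]) = 0 :=
  Polynomial.aeval_X _

/-- The Hopf algebra `k[t]` of the additive group, with antipode `t ↦ -t`. -/
instance gaHopfAlgebra : HopfAlgebra k k[X] :=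
  HopfAlgebra.ofAlgHom (Polynomial.aeval (-Polynomial.X))
    (by
      ext1
      rw [AlgHom.comp_apply, AlgHom.comp_apply, Bialgebra.comulAlgHom_apply,
        Bialgebra.counitAlgHom_apply, ga_comul_X, ga_counit_X, map_zero, map_add]
      erw [Algebra.TensorProduct.lift_tmul, Algebra.TensorProduct.lift_tmul]
      simp)
    (by
      ext1
      simp [ga_comul_X, ga_counit_X])

theorem ga_antipode_X : HopfAlgebra.antipode k (Polynomial.X : k[X]) = -Polynomial.X :=
  Polynomial.aeval_X _

variable (p r : ℕ)

/-- The ideal `(t ^ (p ^ r))` of `k[t]`. -/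
def gaFrobIdeal : Ideal k[X] := Ideal.span {Polynomial.X ^ p ^ r}

theorem map_gaFrobIdeal_eq_zero {B : Type*} [Semiring B] [Algebra k B] (f : k[X] →ₐ[k] B)
    (hf : f Polynomial.X ^ p ^ r = 0) {x : k[X]} (hx : x ∈ gaFrobIdeal k p r) : f x = 0 := by
  obtain ⟨y, rfl⟩ := Ideal.mem_span_singleton'.1 hx
  rw [map_mul, map_pow, hf, mul_zero]

theorem gaFrobIdeal_X_pow :
    (Ideal.Quotient.mk (gaFrobIdeal k p r) Polynomial.X) ^ p ^ r = 0 := by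
  rw [← map_pow]
  exact Ideal.Quotient.eq_zero_iff_mem.2 (Ideal.mem_span_singleton_self _)

theorem add_pow_prime_pow_of_commute {R : Type*} [Ring R] [Fact p.Prime] (hp : (p : R) = 0)
    {x y : R} (h : Commute x y) : (x + y) ^ p ^ r = x ^ p ^ r + y ^ p ^ r := by
  cases subsingleton_or_nontrivial R
  · exact Subsingleton.elim _ _
  · have : CharP R p :=
      (CharP.ringChar_of_prime_eq_zero (Fact.out : p.Prime) hp) ▸ ringChar.charP R
    exact add_pow_char_pow_of_commute p r h

instance gaFrobIdeal_isHopfIdeal [Fact p.Prime] [CharP k p] :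
    (gaFrobIdeal k p r).IsHopfIdeal k where
  counit_eq_zero x hx := by
    refine map_gaFrobIdeal_eq_zero k p r (Bialgebra.counitAlgHom k k[X]) ?_ hx
    rw [Bialgebra.counitAlgHom_apply, ga_counit_X,
      zero_pow (pow_ne_zero _ (Fact.out : p.Prime).ne_zero)]
  map_mkQ_comul_eq_zero x hx := by
    have hp : (p : (k[X] ⧸ gaFrobIdeal k p r) ⊗[k] (k[X] ⧸ gaFrobIdeal k p r)) = 0 := by
      rw [← map_natCast (algebraMap k _), CharP.cast_eq_zero, map_zero]
    refine map_gaFrobIdeal_eq_zero k p r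
      ((Algebra.TensorProduct.map (Ideal.Quotient.mkₐ k (gaFrobIdeal k p r))
        (Ideal.Quotient.mkₐ k (gaFrobIdeal k p r))).comp (Bialgebra.comulAlgHom k k[X])) ?_ hx
    rw [AlgHom.comp_apply, Bialgebra.comulAlgHom_apply, ga_comul_X, map_add]
    simp only [Algebra.TensorProduct.map_tmul, map_one, Ideal.Quotient.mkₐ_eq_mk]
    rw [add_pow_prime_pow_of_commute p r hp ((Commute.one_right _).tmul (Commute.one_left _)),
      Algebra.TensorProduct.tmul_pow, Algebra.TensorProduct.tmul_pow, gaFrobIdeal_X_pow,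
      TensorProduct.zero_tmul, TensorProduct.tmul_zero, add_zero]
  antipode_mem x hx := by
    rw [← Ideal.Quotient.eq_zero_iff_mem]
    refine map_gaFrobIdeal_eq_zero k p r
      ((Ideal.Quotient.mkₐ k (gaFrobIdeal k p r)).comp (HopfAlgebra.antipodeAlgHom k k[X])) ?_ hx
    rw [AlgHom.comp_apply, HopfAlgebra.antipodeAlgHom_apply, ga_antipode_X,
      Ideal.Quotient.mkₐ_eq_mk, map_neg]
    refine (neg_pow (Ideal.Quotient.mk (gaFrobIdeal k p r) Polynomial.X) _).trans ?_
    rw [gaFrobIdeal_X_pow, mul_zero]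

/-- The coordinate ring `k[t] / (t ^ (p ^ r))` of the `r`-th Frobenius kernel `𝔾ₐ₍ᵣ₎`, with the Hopf
algebra structure induced from `k[t]`. -/
abbrev GaFrob : Type _ := k[X] ⧸ gaFrobIdeal k p r

end AdditiveGroup

/-! ### An affine group scheme `H` with coordinate Hopf algebra `A = k[H]` -/

section Group

variable (k A : Type*) [Field k] [CommRing A] [HopfAlgebra k A]

/-- The group `H(k)` of `k`-points (with Mathlib's convolution group structure:
`(g * h)(a) = ∑ g(a₁) h(a₂)`). -/
abbrev Points : Type _ := WithConv (A →ₐ[k] k)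

/-- The algebra of linear functionals on `A = k[H]` under convolution
`(μ * ν)(a) = ∑ μ(a₁) ν(a₂)`; it contains the algebra of distributions `Dist(H)`
as a subalgebra. -/
abbrev Functionals : Type _ := WithConv (A →ₗ[k] k)

variable {k A}

/-- Evaluation at a `k`-point, as a linear functional. -/
def Points.toFunctional (g : Points k A) : Functionals k A := toConv g.ofConv.toLinearMap

theorem Points.toFunctional_mul (g h : Points k A) :
    (g * h).toFunctional = g.toFunctional * h.toFunctional := rfl

theorem Points.toFunctional_one : (1 : Points k A).toFunctional = 1 := rfl

theorem Points.inv_mul_functional (g : Points k A) :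
    (g⁻¹).toFunctional * g.toFunctional = 1 := by
  rw [← Points.toFunctional_mul, inv_mul_cancel, Points.toFunctional_one]

theorem Points.mul_inv_functional (g : Points k A) :
    g.toFunctional * (g⁻¹).toFunctional = 1 := by
  rw [← Points.toFunctional_mul, mul_inv_cancel, Points.toFunctional_one]

open scoped Coalgebra in
/-- The values of a convolution product on products `a * b`. -/
theorem functional_mul_apply_mul {μ ν f g f' g' h l h' l' : Functionals k A}
    (hμ : ∀ a b : A, μ (a * b) = f a * g b + f' a * g' b)
    (hν : ∀ a b : A, ν (a * b) = h a * l b + h' a * l' b) (a b : A) :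
    (μ * ν) (a * b) = (f * h) a * (g * l) b + (f * h') a * (g * l') b +
      (f' * h) a * (g' * l) b + (f' * h') a * (g' * l') b := by
  simp only [((ℛ k a).mul (ℛ k b)).convMul_apply, (ℛ k a).convMul_apply, (ℛ k b).convMul_apply,
    Finset.sum_mul_sum]
  simp only [Coalgebra.Repr.mul_index, Coalgebra.Repr.mul_left, Coalgebra.Repr.mul_right,
    Finset.sum_product, ← Finset.sum_add_distrib, hμ, hν]
  refine Finset.sum_congr rfl fun i _ => Finset.sum_congr rfl fun j _ => ?_
  ring

/-- The Lie ring structure on `Functionals k A` given by commutators `μ * ν - ν * μ`. -/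
instance functionalsLieRing : LieRing (Functionals k A) := LieRing.ofAssociativeRing

/-- The condition that `X` is a point derivation of `k[H]` at the identity, i.e. at the counit. -/
def IsPointDerivation (X : Functionals k A) : Prop :=
  ∀ a b : A, X (a * b) = Coalgebra.counit (R := k) a * X b + X a * Coalgebra.counit (R := k) b

variable (k A) in
/-- The Lie algebra `𝔥 = Lie(H)`: the point derivations of `k[H]` at the identity, with the
commutator bracket of the convolution product. -/
def lie : LieSubalgebra k (Functionals k A) where
  carrier := {X | IsPointDerivation X}
  add_mem' {X Y} hX hY a b := by
    have hX := hX a b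
    have hY := hY a b
    simp only [ofConv_add, LinearMap.add_apply, hX, hY]
    ring
  zero_mem' a b := by simp
  smul_mem' c X hX a b := by
    have hX := hX a b
    simp only [ofConv_smul, LinearMap.smul_apply, smul_eq_mul, hX]
    ring
  lie_mem' {X Y} hX hY a b := by
    have hXY := functional_mul_apply_mul (f := 1) (g := X) (f' := X) (g' := 1) (h := 1) (l := Y)
      (h' := Y) (l' := 1) hX hY a b
    have hYX := functional_mul_apply_mul (f := 1) (g := Y) (f' := Y) (g' := 1) (h := 1) (l := X)
      (h' := X) (l' := 1) hY hX a b
    simp only [mul_one, one_mul, LinearMap.convOne_apply, Algebra.algebraMap_self,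
      RingHom.id_apply] at hXY hYX
    simp only [LieRing.of_associative_ring_bracket, ofConv_sub, LinearMap.sub_apply]
    rw [hXY, hYX]
    ring

theorem isPointDerivation_conj (g : Points k A) {X : Functionals k A} (hX : IsPointDerivation X) :
    IsPointDerivation (g.toFunctional * X * (g⁻¹).toFunctional) := by
  have hmul : ∀ (g : Points k A) (a b : A), g.toFunctional (a * b) =
      g.toFunctional a * g.toFunctional b + (0 : Functionals k A) a * (0 : Functionals k A) b :=
    fun g a b => by simp [Points.toFunctional]
  have h1 : ∀ a b : A, (g.toFunctional * X) (a * b) =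
      g.toFunctional a * (g.toFunctional * X) b + (g.toFunctional * X) a * g.toFunctional b := by
    intro a b
    have := functional_mul_apply_mul (f := g.toFunctional) (g := g.toFunctional) (f' := 0)
      (g' := 0) (h := 1) (l := X) (h' := X) (l' := 1) (hmul g) hX a b
    simpa using this
  intro a b
  have := functional_mul_apply_mul h1 (hmul g⁻¹) a b
  simpa [Points.mul_inv_functional] using this

/-- The adjoint action of `H(k)` on `𝔥`: `g · X = g * X * g⁻¹` in the convolution algebra, i.e.
`X` precomposed with the comorphism of `h ↦ g h g⁻¹`. -/
def Ad (g : Points k A) (X : lie k A) : lie k A :=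
  ⟨g.toFunctional * (X : Functionals k A) * (g⁻¹).toFunctional, isPointDerivation_conj g X.2⟩

theorem conj_pow (g : Points k A) (X : Functionals k A) (n : ℕ) :
    (g.toFunctional * X * (g⁻¹).toFunctional) ^ n =
      g.toFunctional * X ^ n * (g⁻¹).toFunctional := by
  induction n with
  | zero => simp [Points.mul_inv_functional]
  | succ n ih =>
    rw [pow_succ, ih, pow_succ]
    simp only [mul_assoc]
    rw [← mul_assoc (g⁻¹).toFunctional, Points.inv_mul_functional, one_mul]

variable (k A) in
/-- The restricted nullcone `𝒩₁(𝔥)`: the elements `X` of `𝔥` with `X^[p] = 0`, the `[p]`-map being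
the `p`-th power in the convolution algebra. -/
def Nullcone (p : ℕ) : Type _ := {X : lie k A // (X : Functionals k A) ^ p = 0}

namespace Nullcone

variable {p : ℕ}

/-- The scalar multiple `s X` of an element of the restricted nullcone. -/
def smul (s : k) (X : Nullcone k A p) : Nullcone k A p :=
  ⟨s • X.1, by
    change (s • (X.1 : Functionals k A)) ^ p = 0
    rw [smul_pow, X.2, smul_zero]⟩

/-- The adjoint action on the restricted nullcone. -/
def conj (g : Points k A) (X : Nullcone k A p) : Nullcone k A p :=
  ⟨Ad g X.1, by
    change (g.toFunctional * _ * (g⁻¹).toFunctional) ^ p = 0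
    rw [conj_pow, X.2, mul_zero, zero_mul]⟩

end Nullcone

variable (k A) in
/-- `𝒞ᵣ(𝒩₁(𝔥))`: the `r`-tuples of pairwise commuting elements of the restricted nullcone. -/
def CommTuples (p r : ℕ) : Type _ :=
  {X : Fin r → Nullcone k A p // ∀ i j, ⁅(X i).1, (X j).1⁆ = 0}

/-- The homomorphism of group schemes `𝔾ₐ → H` with comorphism `ψ : k[H] → k[t]` is given on
`k`-points by `s ↦ f s`. -/
def IsGivenBy (ψ : A →ₐc[k] k[X]) (f : k → Points k A) : Prop :=
  ∀ (s : k) (a : A), (ψ a).eval s = f s a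

/-- Over an infinite field a one-parameter subgroup is determined by its effect on points. -/
theorem IsGivenBy.unique [Infinite k] {ψ φ : A →ₐc[k] k[X]} {f : k → Points k A}
    (hψ : IsGivenBy ψ f) (hφ : IsGivenBy φ f) : ψ = φ := by
  ext1 a
  exact Polynomial.funext fun s => (hψ s a).trans (hφ s a).symm

/-- `E : 𝒩₁(𝔥) → H(k)` is an exponential map for `H`. -/
structure IsExponentialMap {p : ℕ} (E : Nullcone k A p → Points k A) : Prop where
  injective : Function.Injective E
  equivariant : ∀ (g : Points k A) (X : Nullcone k A p), E (X.conj g) = g * E X * g⁻¹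
  /-- `s ↦ E(sX)` is a one-parameter subgroup `ψ : 𝔾ₐ → H`, and its differential sends the
  distribution `u₀` (the coefficient of `t`) to `X`. -/
  oneParameter : ∀ X : Nullcone k A p, ∃ ψ : A →ₐc[k] k[X],
    IsGivenBy ψ (fun s => E (X.smul s)) ∧
      ∀ a : A, (Polynomial.lcoeff k 1) (ψ a) = (X.1 : Functionals k A) a
  /-- `E(sX)` acts trivially on the centralizer of `X` in `𝔥`. -/
  trivial_on_centralizer : ∀ (X : Nullcone k A p) (s : k) (Y : lie k A),
    ⁅X.1, Y⁆ = 0 → Ad (E (X.smul s)) Y = Y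

/-- The restriction of a one-parameter subgroup `𝔾ₐ → H` to `𝔾ₐ₍ᵣ₎`. -/
def restrict (p r : ℕ) [Fact p.Prime] [CharP k p] (ψ : A →ₐc[k] k[X]) :
    A →ₐc[k] GaFrob k p r :=
  (Bialgebra.Quotient.mkBialgHom (R := k) (gaFrobIdeal k p r)).comp ψ

end Group

end ExpGroup

end

/-!
Write `D` for the convolution algebra of functionals on `A = k[H]`. A homomorphism out of `𝔾ₐ` or
`𝔾ₐ₍ᵣ₎` is recorded by the functionals `v n ∈ D` giving the coefficients of `t ^ n` in its
comorphism. Compatibility with comultiplication says that they form a divided power sequence,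
`v i * v j = (i + j choose i) • v (i + j)`. In characteristic `p` such a sequence consists of
commuting elements, satisfies `v (p ^ m) ^ p = 0`, and is determined below `p ^ (m + 1)` by its terms
up to `p ^ m` (`IsDividedPowerSeq.eq_of_lt_pow_succ`).

If `[X, Y] = 0`, then `E(sX)` fixes `tY` under the adjoint action, hence commutes with `E(tY)` by
equivariance. So the product `s ↦ ∏ E(s ^ (p ^ i) X_i)` over a commuting tuple is additive in `s`, and
over an infinite field it is therefore a homomorphism of algebraic groups
(`exists_bialgHom_of_evalPoint_add`). Appending `X_m` to a tuple `X₀, …, X_{m - 1}` leaves the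
coefficients of `t ^ n` with `n < p ^ m` unchanged and adds `X_m` to the one of `t ^ (p ^ m)`
(`exists_isGivenBy_tuplePoint_succ`). Injectivity follows by induction on the length of the tuple.

For surjectivity, let `v n` be the coefficients of `Φ : 𝔾ₐ₍ᵣ₎ → H`, and suppose that
`X₀, …, X_{m - 1}` have been found such that the coefficients `w n` of their one-parameter subgroup
agree with `v n` for `n < p ^ m`. Then `Z = v (p ^ m) - w (p ^ m)` is a point derivation, since the
Leibniz formulas of the two terms have the same inner part (`isPointDerivation_sub`). It commutes
with every `w n = v n`, `n < p ^ m`, because both sequences are commutative. From this and the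
triviality of `E(sX)` on the centralizer of `X`, it commutes with `X₀, X₁, …` one after the other
(`lie_eq_zero_of_commute_coeffFunctional`), and then with all `w n`. Hence
`Z ^ p = v (p ^ m) ^ p - w (p ^ m) ^ p = 0`, and `X_m = Z` continues the tuple
(`exists_tuple_coeffFunctional_eq`). No equivariance of `E` beyond `k`-points is needed.
-/

noncomputable section

namespace ExpGroup

/-! ### Divided power sequences -/

/-- A sequence `v` in a ring is a divided power sequence if `v 0 = 1` and
`v i * v j = (i + j choose i) • v (i + j)`, as for the sequence `x ^ i / i!`. -/
structure IsDividedPowerSeq {R : Type*} [Ring R] (v : ℕ → R) : Prop where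
  zero : v 0 = 1
  mul : ∀ i j, v i * v j = (i + j).choose i • v (i + j)

namespace IsDividedPowerSeq

variable {R : Type*} [Ring R] {v w : ℕ → R}

theorem commute (hv : IsDividedPowerSeq v) (i j : ℕ) : Commute (v i) (v j) := by
  rw [Commute, SemiconjBy, hv.mul, hv.mul, add_comm j i, Nat.choose_symm_add]

theorem exists_pow_eq_smul (hv : IsDividedPowerSeq v) (a j : ℕ) :
    ∃ c : ℕ, v a ^ j = c • v (j * a) := by
  induction j with
  | zero => exact ⟨1, by simp [hv.zero]⟩
  | succ j ih =>
    obtain ⟨c, hc⟩ := ih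
    refine ⟨c * (j * a + a).choose (j * a), ?_⟩
    rw [pow_succ, hc, smul_mul_assoc, hv.mul, smul_smul, Nat.succ_mul]

variable {p : ℕ} [hp : Fact p.Prime]

theorem pow_prime_eq_zero (hv : IsDividedPowerSeq v) (hR : (p : R) = 0) (m : ℕ) :
    v (p ^ m) ^ p = 0 := by
  have hp1 := hp.out.one_le
  obtain ⟨c, hc⟩ := hv.exists_pow_eq_smul (p ^ m) (p - 1)
  have hexp : (p - 1) * p ^ m + p ^ m = p ^ (m + 1) := by
    rw [← Nat.succ_mul, Nat.succ_eq_add_one, Nat.sub_add_cancel hp1, pow_succ, mul_comm]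
  have hdvd : p ∣ (p ^ (m + 1)).choose ((p - 1) * p ^ m) := by
    refine hp.out.dvd_choose_pow ?_ ?_
    · exact mul_ne_zero (by have := hp.out.two_le; omega) (pow_ne_zero _ hp.out.ne_zero)
    · have : 0 < p ^ m := pow_pos hp.out.pos m
      omega
  rw [← pow_sub_one_mul hp.out.ne_zero, hc, smul_mul_assoc, hv.mul, hexp]
  obtain ⟨d, hd⟩ := hdvd
  rw [hd, nsmul_eq_mul, nsmul_eq_mul]
  simp [hR]

end IsDividedPowerSeq

theorem not_dvd_choose_prime_pow {p : ℕ} [hp : Fact p.Prime] (m : ℕ) {n : ℕ} (h1 : p ^ m ≤ n)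
    (h2 : n < p ^ (m + 1)) : ¬ p ∣ n.choose (p ^ m) := by
  induction m generalizing n with
  | zero =>
    simp only [pow_zero, zero_add, pow_one, Nat.choose_one_right] at *
    exact Nat.not_dvd_of_pos_of_lt h1 h2
  | succ m ih =>
    have hlucas := Choose.choose_modEq_choose_mod_mul_choose_div_nat (n := n) (k := p ^ (m + 1))
      (p := p)
    rw [hlucas.dvd_iff dvd_rfl]
    have h3 : p ^ (m + 1) % p = 0 := Nat.mod_eq_zero_of_dvd (dvd_pow_self p m.succ_ne_zero)
    have h4 : p ^ (m + 1) / p = p ^ m := by rw [pow_succ, Nat.mul_div_cancel _ hp.out.pos]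
    rw [h3, h4, Nat.choose_zero_right, one_mul]
    refine ih ?_ ?_
    · rwa [Nat.le_div_iff_mul_le hp.out.pos, ← pow_succ]
    · rwa [Nat.div_lt_iff_lt_mul hp.out.pos, ← pow_succ]

/-- In characteristic `p` a divided power sequence is determined below `p ^ (m + 1)` by its terms
up to `p ^ m`, because `v (p ^ m) * v b` is a nonzero multiple of `v (p ^ m + b)` in that range. -/
theorem IsDividedPowerSeq.eq_of_lt_pow_succ (k : Type*) {R : Type*} [Field k] [Ring R] [Algebra k R]
    {p : ℕ} [hp : Fact p.Prime] [CharP k p] {v w : ℕ → R} (hv : IsDividedPowerSeq v)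
    (hw : IsDividedPowerSeq w) {m : ℕ} (h : ∀ n ≤ p ^ m, v n = w n) {n : ℕ}
    (hn : n < p ^ (m + 1)) : v n = w n := by
  induction n using Nat.strong_induction_on with
  | _ n ih =>
    rcases le_or_gt n (p ^ m) with hle | hlt
    · exact h n hle
    have hpos : 0 < p ^ m := pow_pos hp.out.pos m
    obtain ⟨b, rfl⟩ := Nat.exists_eq_add_of_lt hlt
    have hb : v (b + 1) = w (b + 1) := ih _ (by omega) (by omega)
    have hc : ((p ^ m + (b + 1)).choose (p ^ m) : k) ≠ 0 := by
      rw [Ne, CharP.cast_eq_zero_iff k p]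
      exact not_dvd_choose_prime_pow m (by omega) hn
    have := hv.mul (p ^ m) (b + 1)
    rw [h _ le_rfl, hb, hw.mul, ← Nat.cast_smul_eq_nsmul k, ← Nat.cast_smul_eq_nsmul k] at this
    exact (smul_right_injective R hc this).symm

/-! ### Coefficient functionals of `𝔾ₐ` and its Frobenius kernels -/

section Coeff

variable {k A : Type*} [Field k] [CommRing A] [HopfAlgebra k A]

/-- A sequence of functionals on a coalgebra stays a divided power sequence after precomposition
with a coalgebra homomorphism. -/
theorem IsDividedPowerSeq.comp {B C : Type*} [AddCommGroup B] [Module k B] [Coalgebra k B]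
    [AddCommGroup C] [Module k C] [Coalgebra k C]
    {v : ℕ → WithConv (C →ₗ[k] k)} (hv : IsDividedPowerSeq v) (φ : B →ₗc[k] C) :
    IsDividedPowerSeq fun n => (toConv ((v n).ofConv ∘ₗ φ.toLinearMap) : WithConv (B →ₗ[k] k)) where
  zero := by
    rw [hv.zero]
    ext b
    simp
  mul i j := by
    have := LinearMap.convMul_comp_coalgHom_distrib (v i) (v j) φ
    rw [hv.mul] at this
    apply WithConv.ofConv_injective
    rw [← this]
    rfl

theorem ga_comul_X_pow (n : ℕ) : Coalgebra.comul (R := k) (Polynomial.X ^ n : k[X]) =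
    ∑ i ∈ Finset.range (n + 1), (n.choose i : k) •
      ((Polynomial.X ^ i : k[X]) ⊗ₜ[k] (Polynomial.X ^ (n - i) : k[X])) := by
  rw [Bialgebra.comul_pow, ga_comul_X,
    ((Commute.one_right _).tmul (Commute.one_left _)).add_pow]
  refine Finset.sum_congr rfl fun i _ => ?_
  rw [Algebra.TensorProduct.tmul_pow, Algebra.TensorProduct.tmul_pow,
    Algebra.TensorProduct.tmul_mul_tmul, one_pow, one_pow, mul_one, one_mul,
    Nat.cast_smul_eq_nsmul, nsmul_eq_mul, mul_comm]

theorem lcoeff_mul_lcoeff_X_pow (i j n : ℕ) :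
    ((toConv (Polynomial.lcoeff k i) * toConv (Polynomial.lcoeff k j) :
      WithConv (k[X] →ₗ[k] k)) (Polynomial.X ^ n) : k) =
        if n = i + j then ((i + j).choose i : k) else 0 := by
  rw [LinearMap.convMul_apply, ga_comul_X_pow]
  simp only [map_sum, map_smul, TensorProduct.map_tmul, LinearMap.mul'_apply,
    Polynomial.lcoeff_apply, Polynomial.coeff_X_pow, smul_eq_mul]
  split_ifs with h
  · subst h
    rw [Finset.sum_eq_single i]
    · simp
    · intro b _ hb
      simp [hb.symm]
    · simp
  · refine Finset.sum_eq_zero fun b hb => ?_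
    have := Finset.mem_range.1 hb
    split_ifs <;> first | omega | simp

theorem isDividedPowerSeq_lcoeff :
    IsDividedPowerSeq fun n => (toConv (Polynomial.lcoeff k n) : WithConv (k[X] →ₗ[k] k)) where
  zero := by
    apply WithConv.ofConv_injective
    refine Polynomial.lhom_ext' fun n => LinearMap.ext_ring ?_
    change (Polynomial.monomial n (1 : k)).coeff 0 = Coalgebra.counit (R := k) (Polynomial.monomial n (1 : k))
    rw [Polynomial.monomial_one_right_eq_X_pow, Bialgebra.counit_pow, ga_counit_X]
    cases n <;> simp
  mul i j := by
    apply WithConv.ofConv_injective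
    refine Polynomial.lhom_ext' fun n => LinearMap.ext_ring ?_
    change ((toConv (Polynomial.lcoeff k i) * toConv (Polynomial.lcoeff k j) :
      WithConv (k[X] →ₗ[k] k)) (Polynomial.monomial n 1) : k) =
        (i + j).choose i • (Polynomial.monomial n (1 : k)).coeff (i + j)
    rw [Polynomial.monomial_one_right_eq_X_pow, lcoeff_mul_lcoeff_X_pow, Polynomial.coeff_X_pow]
    simp [eq_comm]

/-- The functionals on `k[t] / (t ^ (p ^ r))` reading off the coefficient of `t ^ n`; they are zero
for `n ≥ p ^ r`. -/
def frobCoeff (k : Type*) [Field k] (p r n : ℕ) : GaFrob k p r →ₗ[k] k :=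
  ((gaFrobIdeal k p r).restrictScalars k).liftQ
    (if n < p ^ r then Polynomial.lcoeff k n else 0) (by
      intro f hf
      split_ifs with h
      · exact Polynomial.X_pow_dvd_iff.1 (Ideal.mem_span_singleton.1 hf) n h
      · exact LinearMap.mem_ker.2 rfl) ∘ₗ
    (Submodule.Quotient.restrictScalarsEquiv k (gaFrobIdeal k p r)).symm.toLinearMap

theorem frobCoeff_mk (p r n : ℕ) (f : k[X]) :
    frobCoeff k p r n (Ideal.Quotient.mk _ f) = if n < p ^ r then f.coeff n else 0 := by
  change (if n < p ^ r then Polynomial.lcoeff k n else 0) f = _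
  split_ifs <;> rfl

theorem gaFrob_ext {p r : ℕ} {x y : GaFrob k p r}
    (h : ∀ n < p ^ r, frobCoeff k p r n x = frobCoeff k p r n y) : x = y := by
  obtain ⟨f, rfl⟩ := Ideal.Quotient.mk_surjective x
  obtain ⟨g, rfl⟩ := Ideal.Quotient.mk_surjective y
  refine Ideal.Quotient.eq.2 (Ideal.mem_span_singleton.2 (Polynomial.X_pow_dvd_iff.2 ?_))
  intro n hn
  have := h n hn
  rw [frobCoeff_mk, frobCoeff_mk, if_pos hn, if_pos hn] at this
  rw [Polynomial.coeff_sub, this, sub_self]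

theorem frobCoeff_mul {p r n : ℕ} (hn : n < p ^ r) (x y : GaFrob k p r) :
    frobCoeff k p r n (x * y) =
      ∑ ij ∈ Finset.HasAntidiagonal.antidiagonal n,
        frobCoeff k p r ij.1 x * frobCoeff k p r ij.2 y := by
  obtain ⟨f, rfl⟩ := Ideal.Quotient.mk_surjective x
  obtain ⟨g, rfl⟩ := Ideal.Quotient.mk_surjective y
  rw [← map_mul, frobCoeff_mk, if_pos hn, Polynomial.coeff_mul]
  refine Finset.sum_congr rfl fun ij hij => ?_
  have := Finset.HasAntidiagonal.mem_antidiagonal.1 hij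
  rw [frobCoeff_mk, frobCoeff_mk, if_pos (by omega), if_pos (by omega)]

theorem gaFrob_linearMap_ext {p r : ℕ} {f g : GaFrob k p r →ₗ[k] k}
    (h : ∀ n < p ^ r, f (Ideal.Quotient.mk _ (Polynomial.X ^ n)) =
      g (Ideal.Quotient.mk _ (Polynomial.X ^ n))) : f = g := by
  have : f ∘ₗ (Ideal.Quotient.mkₐ k (gaFrobIdeal k p r)).toLinearMap =
      g ∘ₗ (Ideal.Quotient.mkₐ k (gaFrobIdeal k p r)).toLinearMap := by
    refine Polynomial.lhom_ext' fun n => LinearMap.ext_ring ?_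
    change f (Ideal.Quotient.mk _ (Polynomial.monomial n 1)) =
      g (Ideal.Quotient.mk _ (Polynomial.monomial n 1))
    rw [Polynomial.monomial_one_right_eq_X_pow]
    rcases lt_or_ge n (p ^ r) with hn | hn
    · exact h n hn
    · have : Ideal.Quotient.mk (gaFrobIdeal k p r) (Polynomial.X ^ n) = 0 :=
        Ideal.Quotient.eq_zero_iff_mem.2
          (Ideal.mem_span_singleton.2 (pow_dvd_pow _ hn))
      rw [this, map_zero, map_zero]
  refine LinearMap.ext fun x => ?_
  obtain ⟨x, rfl⟩ := Ideal.Quotient.mk_surjective x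
  exact LinearMap.congr_fun this x

theorem isDividedPowerSeq_frobCoeff (p r : ℕ) [Fact p.Prime] [CharP k p] :
    IsDividedPowerSeq fun n =>
      (toConv (frobCoeff k p r n) : WithConv (GaFrob k p r →ₗ[k] k)) where
  zero := by
    apply WithConv.ofConv_injective
    refine gaFrob_linearMap_ext fun n hn => ?_
    refine (frobCoeff_mk p r 0 _).trans ?_
    rw [if_pos (by omega)]
    exact congrArg (fun v : WithConv (k[X] →ₗ[k] k) => v (Polynomial.X ^ n))
      (isDividedPowerSeq_lcoeff (k := k)).zero
  mul i j := by
    apply WithConv.ofConv_injective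
    refine gaFrob_linearMap_ext fun n hn => ?_
    have h1 := LinearMap.congr_fun (LinearMap.convMul_comp_coalgHom_distrib
      (toConv (frobCoeff k p r i)) (toConv (frobCoeff k p r j))
      (Bialgebra.Quotient.mkBialgHom (R := k) (gaFrobIdeal k p r)).toCoalgHom) (Polynomial.X ^ n)
    refine h1.trans ?_
    change _ = (i + j).choose i • frobCoeff k p r (i + j) (Ideal.Quotient.mk _ (Polynomial.X ^ n))
    have h2 : ∀ i, frobCoeff k p r i ∘ₗ
        (Bialgebra.Quotient.mkBialgHom (R := k) (gaFrobIdeal k p r)).toCoalgHom.toLinearMap =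
        if i < p ^ r then Polynomial.lcoeff k i else 0 := by
      intro i
      ext f
      refine (frobCoeff_mk p r i _).trans ?_
      split_ifs <;> rfl
    simp only [h2]
    rw [frobCoeff_mk, Polynomial.coeff_X_pow]
    by_cases hij : i < p ^ r ∧ j < p ^ r
    · rw [if_pos hij.1, if_pos hij.2, lcoeff_mul_lcoeff_X_pow]
      split_ifs <;> first | omega | simp
    · rw [if_neg (by omega : ¬ i + j < p ^ r), smul_zero]
      rcases not_and_or.1 hij with h | h <;> simp [h]

end Coeff

/-! ### One-parameter subgroups on points -/

section OneParameter

variable {k A : Type*} [Field k] [CommRing A] [HopfAlgebra k A]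

/-- The `k`-point of `H` obtained by evaluating a morphism `𝔸¹ → H`, with comorphism `ψ`, at `s`. -/
def evalPoint (ψ : A →ₐ[k] k[X]) (s : k) : Points k A :=
  toConv ((Polynomial.aeval s).comp ψ)

theorem evalPoint_apply (ψ : A →ₐ[k] k[X]) (s : k) (a : A) :
    evalPoint ψ s a = (ψ a).eval s := by
  change Polynomial.aeval s (ψ a) = _
  rw [Polynomial.coe_aeval_eq_eval]

theorem IsGivenBy.evalPoint_eq {ψ : A →ₐc[k] k[X]} {f : k → Points k A} (h : IsGivenBy ψ f)
    (s : k) : evalPoint (ψ : A →ₐ[k] k[X]) s = f s := by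
  apply WithConv.ofConv_injective
  ext a
  exact (evalPoint_apply _ s a).trans (h s a)

theorem evalPoint_convMul (ψ φ : A →ₐ[k] k[X]) (s : k) :
    evalPoint (toConv ψ * toConv φ).ofConv s = evalPoint ψ s * evalPoint φ s :=
  congrArg toConv (AlgHom.comp_convMul_distrib (Polynomial.aeval s) (toConv ψ) (toConv φ))

theorem evalPoint_expand_comp (φ : A →ₐ[k] k[X]) (N : ℕ) (s : k) :
    evalPoint ((Polynomial.expand k N).comp φ) s = evalPoint φ (s ^ N) := by
  apply WithConv.ofConv_injective
  ext a
  refine (evalPoint_apply _ s a).trans (Eq.trans ?_ (evalPoint_apply φ _ a).symm)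
  exact Polynomial.expand_eval N _ s

/-- Evaluation of functions on `𝔾ₐ × 𝔾ₐ` at the point `(s, t)`. -/
def evalPair (s t : k) : k[X] ⊗[k] k[X] →ₐ[k] k :=
  Algebra.TensorProduct.lift (Polynomial.aeval s) (Polynomial.aeval t) fun _ _ => .all ..

theorem eq_zero_of_evalPair [Infinite k] {z : k[X] ⊗[k] k[X]}
    (h : ∀ s t : k, evalPair s t z = 0) :
    z = 0 := by
  obtain ⟨P, rfl⟩ := (polyEquivTensor k k[X]).surjective z
  have key : ∀ s t : k, evalPair s t (polyEquivTensor k k[X] P) =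
      (P.eval (Polynomial.C t)).eval s := by
    intro s t
    clear h
    induction P using Polynomial.induction_on' with
    | add P Q hP hQ => simp_all
    | monomial n f =>
      simp [evalPair, Polynomial.eval₂_monomial, ← Polynomial.coe_aeval_eq_eval]
  have hP : P = 0 := by
    refine Polynomial.eq_zero_of_infinite_isRoot P
      ((Set.infinite_range_of_injective (Polynomial.C_injective (R := k))).mono ?_)
    rintro _ ⟨t, rfl⟩
    exact Polynomial.funext fun s => by rw [← key, h, Polynomial.eval_zero]
  rw [hP, map_zero]

theorem evalPair_comul (s t : k) :
    (evalPair s t).comp (Bialgebra.comulAlgHom k k[X]) = Polynomial.aeval (s + t) := by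
  refine Polynomial.algHom_ext ?_
  simp [evalPair, ga_comul_X]

theorem evalPair_map_comul (ψ : A →ₐ[k] k[X]) (s t : k) :
    toConv ((evalPair s t).comp
      ((Algebra.TensorProduct.map ψ ψ).comp (Bialgebra.comulAlgHom k A))) =
        evalPoint ψ s * evalPoint ψ t := by
  apply WithConv.ofConv_injective
  ext a
  rw [AlgHom.convMul_apply]
  simp only [AlgHom.comp_apply, Bialgebra.comulAlgHom_apply]
  rw [← AlgHom.comp_apply]
  congr 1
  ext <;> simp [evalPair, evalPoint]

theorem evalPoint_add (ψ : A →ₐc[k] k[X]) (s t : k) :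
    evalPoint (ψ : A →ₐ[k] k[X]) (s + t) =
      evalPoint (ψ : A →ₐ[k] k[X]) s * evalPoint (ψ : A →ₐ[k] k[X]) t := by
  have h := BialgHomClass.map_comp_comulAlgHom (R := k) ψ
  rw [← evalPair_map_comul]
  refine congrArg toConv ?_
  rw [← evalPair_comul, AlgHom.comp_assoc]
  exact congrArg (evalPair s t).comp h.symm

/-- Over an infinite field, a morphism `𝔸¹ → H` that is additive on `k`-points is a homomorphism
of algebraic groups. -/
theorem exists_bialgHom_of_evalPoint_add [Infinite k] (ψ : A →ₐ[k] k[X])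
    (h : ∀ s t, evalPoint ψ (s + t) = evalPoint ψ s * evalPoint ψ t) :
    ∃ Ψ : A →ₐc[k] k[X], (Ψ : A →ₐ[k] k[X]) = ψ := by
  refine ⟨BialgHom.ofAlgHom ψ ?_ ?_, rfl⟩
  · have h0 : evalPoint ψ 0 = 1 := by
      have := h 0 0
      rw [add_zero] at this
      exact left_eq_mul.1 this
    ext a
    have := congrArg (fun g : Points k A => g a) h0
    refine Eq.trans ?_ this
    rfl
  · ext a
    rw [← sub_eq_zero]
    refine eq_zero_of_evalPair fun s t => ?_
    rw [map_sub, sub_eq_zero]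
    have h1 := congrArg (fun g : Points k A => g a) ((evalPair_map_comul ψ s t).trans (h s t).symm)
    refine h1.trans ?_
    exact (AlgHom.congr_fun (evalPair_comul s t) (ψ a)).symm

/-! ### Coefficients of one-parameter subgroups -/

/-- The coefficient of `t ^ n` in a morphism `𝔸¹ → H`, as a functional on `k[H]`. -/
def coeffFunctional (ψ : A →ₐ[k] k[X]) (n : ℕ) : Functionals k A :=
  toConv (Polynomial.lcoeff k n ∘ₗ ψ.toLinearMap)

theorem isDividedPowerSeq_coeffFunctional (ψ : A →ₐc[k] k[X]) :
    IsDividedPowerSeq (coeffFunctional (ψ : A →ₐ[k] k[X])) :=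
  isDividedPowerSeq_lcoeff.comp ψ.toCoalgHom

open scoped Coalgebra in
theorem commute_coeffFunctional [Infinite k] {ψ : A →ₐ[k] k[X]} {Y : Functionals k A}
    (h : ∀ s, Commute (evalPoint ψ s).toFunctional Y) (n : ℕ) :
    Commute (coeffFunctional ψ n) Y := by
  apply WithConv.ofConv_injective
  ext a
  have key : ∑ i ∈ (ℛ k a).index, ψ ((ℛ k a).left i) * Polynomial.C (Y ((ℛ k a).right i)) =
      ∑ i ∈ (ℛ k a).index, Polynomial.C (Y ((ℛ k a).left i)) * ψ ((ℛ k a).right i) := by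
    refine Polynomial.funext fun s => ?_
    have hs := congrArg (fun f : Functionals k A => f a) (h s)
    simp only [(ℛ k a).convMul_apply] at hs
    simp only [Polynomial.eval_finsetSum, Polynomial.eval_mul, Polynomial.eval_C,
      ← evalPoint_apply]
    exact hs
  have := congrArg (fun f : k[X] => f.coeff n) key
  simp only [Polynomial.finsetSum_coeff, Polynomial.coeff_mul_C, Polynomial.coeff_C_mul] at this
  exact ((ℛ k a).convMul_apply (coeffFunctional ψ n) Y).trans
    (this.trans ((ℛ k a).convMul_apply Y (coeffFunctional ψ n)).symm)

theorem coeff_mul_expand_of_lt {N n : ℕ} (hn : n < N) (f g : k[X]) :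
    (f * Polynomial.expand k N g).coeff n = f.coeff n * g.coeff 0 := by
  rw [Polynomial.coeff_mul, Finset.sum_eq_single (n, 0)]
  · rw [Polynomial.coeff_expand (by omega), if_pos (dvd_zero _), Nat.zero_div]
  · rintro ⟨i, j⟩ hij hne
    have hij := Finset.HasAntidiagonal.mem_antidiagonal.1 hij
    have : j ≠ 0 := by rintro rfl; exact hne (by simp_all)
    simp only at hij
    rw [Polynomial.coeff_expand (by omega),
      if_neg (Nat.not_dvd_of_pos_of_lt (by omega) (by omega)), mul_zero]
  · simp

theorem coeff_mul_expand_self {N : ℕ} (hN : N ≠ 0) (f g : k[X]) :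
    (f * Polynomial.expand k N g).coeff N = f.coeff N * g.coeff 0 + f.coeff 0 * g.coeff 1 := by
  have hN0 : 0 < N := Nat.pos_of_ne_zero hN
  rw [Polynomial.coeff_mul, Finset.sum_eq_add (N, 0) (0, N)]
  · rw [Polynomial.coeff_expand hN0, Polynomial.coeff_expand hN0, if_pos (dvd_zero _),
      if_pos dvd_rfl, Nat.zero_div, Nat.div_self hN0]
  · simp [hN]
  · rintro ⟨i, j⟩ hij ⟨h1, h2⟩
    have hij := Finset.HasAntidiagonal.mem_antidiagonal.1 hij
    simp only at hij
    have hj : j ≠ 0 := by rintro rfl; exact h1 (by simp_all)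
    have hjN : j ≠ N := by rintro rfl; exact h2 (by simp_all)
    rw [Polynomial.coeff_expand hN0,
      if_neg (Nat.not_dvd_of_pos_of_lt (by omega) (by omega)), mul_zero]
  · simp
  · simp

open scoped Coalgebra in
theorem coeffFunctional_mul_expand_of_lt {N n : ℕ} (hn : n < N) (ψ : A →ₐ[k] k[X])
    {φ : A →ₐ[k] k[X]} (hφ : coeffFunctional φ 0 = 1) :
    coeffFunctional (toConv ψ * toConv ((Polynomial.expand k N).comp φ)).ofConv n =
      coeffFunctional ψ n := by
  rw [← mul_one (coeffFunctional ψ n), ← hφ]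
  apply WithConv.ofConv_injective
  ext a
  refine (congrArg (fun f : k[X] => f.coeff n)
    ((ℛ k a).convMul_apply (toConv ψ.toLinearMap)
      (toConv ((Polynomial.expand k N).comp φ).toLinearMap))).trans
        (Eq.trans ?_ ((ℛ k a).convMul_apply (coeffFunctional ψ n) (coeffFunctional φ 0)).symm)
  rw [Polynomial.finsetSum_coeff]
  exact Finset.sum_congr rfl fun i _ => coeff_mul_expand_of_lt hn _ _

open scoped Coalgebra in
theorem coeffFunctional_mul_expand_self {N : ℕ} (hN : N ≠ 0) {ψ φ : A →ₐ[k] k[X]}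
    (hψ : coeffFunctional ψ 0 = 1) (hφ : coeffFunctional φ 0 = 1) :
    coeffFunctional (toConv ψ * toConv ((Polynomial.expand k N).comp φ)).ofConv N =
      coeffFunctional ψ N + coeffFunctional φ 1 := by
  have h1 : coeffFunctional ψ N + coeffFunctional φ 1 =
      coeffFunctional ψ N * coeffFunctional φ 0 + coeffFunctional ψ 0 * coeffFunctional φ 1 := by
    rw [hψ, hφ, mul_one, one_mul]
  rw [h1]
  apply WithConv.ofConv_injective
  ext a
  refine (congrArg (fun f : k[X] => f.coeff N)
    ((ℛ k a).convMul_apply (toConv ψ.toLinearMap)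
      (toConv ((Polynomial.expand k N).comp φ).toLinearMap))).trans
        (Eq.trans ?_ (congrArg₂ (· + ·)
          ((ℛ k a).convMul_apply (coeffFunctional ψ N) (coeffFunctional φ 0))
          ((ℛ k a).convMul_apply (coeffFunctional ψ 0) (coeffFunctional φ 1))).symm)
  rw [Polynomial.finsetSum_coeff, ← Finset.sum_add_distrib]
  exact Finset.sum_congr rfl fun i _ => coeff_mul_expand_self hN _ _

/-- Two higher derivations at the identity that agree below order `N` differ at order `N` by a
point derivation: the Leibniz formulas have the same terms apart from the two outer ones. -/
theorem isPointDerivation_sub {v w : ℕ → Functionals k A} {N : ℕ} (hN : N ≠ 0)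
    (hv : ∀ a b, v N (a * b) = ∑ ij ∈ Finset.HasAntidiagonal.antidiagonal N,
      v ij.1 a * v ij.2 b)
    (hw : ∀ a b, w N (a * b) = ∑ ij ∈ Finset.HasAntidiagonal.antidiagonal N,
      w ij.1 a * w ij.2 b)
    (h0 : v 0 = 1) (h : ∀ n < N, v n = w n) : IsPointDerivation (v N - w N) := by
  intro a b
  obtain ⟨M, rfl⟩ := Nat.exists_eq_succ_of_ne_zero hN
  have hw0 : w 0 = 1 := (h 0 (Nat.succ_pos M)).symm.trans h0
  rw [ofConv_sub, LinearMap.sub_apply, LinearMap.sub_apply, LinearMap.sub_apply, hv, hw,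
    Finset.Nat.sum_antidiagonal_eq_sum_range_succ_mk,
    Finset.Nat.sum_antidiagonal_eq_sum_range_succ_mk]
  rw [Finset.sum_range_succ, Finset.sum_range_succ', Finset.sum_range_succ _ (M + 1),
    Finset.sum_range_succ' _ M]
  have hmid : ∀ i ∈ Finset.range M, v (i + 1) a * v (M + 1 - (i + 1)) b =
      w (i + 1) a * w (M + 1 - (i + 1)) b := by
    intro i hi
    have := Finset.mem_range.1 hi
    rw [h (i + 1) (by omega), h (M + 1 - (i + 1)) (by omega)]
  rw [Finset.sum_congr rfl hmid]
  simp only [Nat.sub_self, Nat.sub_zero, h0, hw0, LinearMap.convOne_apply, Algebra.algebraMap_self,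
    RingHom.id_apply, Nat.succ_eq_add_one]
  ring

end OneParameter

/-! ### Points attached to commuting tuples -/

section Exponential

variable {k A : Type*} [Field k] [CommRing A] [HopfAlgebra k A] {p : ℕ}
  {E : Nullcone k A p → Points k A}

theorem IsExponentialMap.commute_functional (hE : IsExponentialMap E) {X : Nullcone k A p}
    {Y : lie k A} (h : ⁅X.1, Y⁆ = 0) (s : k) :
    Commute (E (X.smul s)).toFunctional (Y : Functionals k A) := by
  have h1 := congrArg Subtype.val (hE.trivial_on_centralizer X s Y h)
  change (E (X.smul s)).toFunctional * (Y : Functionals k A) * (E (X.smul s))⁻¹.toFunctional = Y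
    at h1
  have h2 := congrArg (· * (E (X.smul s)).toFunctional) h1
  simp only [mul_assoc, Points.inv_mul_functional, mul_one] at h2
  exact h2

theorem IsExponentialMap.commute_points (hE : IsExponentialMap E) {X Y : Nullcone k A p}
    (h : ⁅X.1, Y.1⁆ = 0) (s t : k) : Commute (E (X.smul s)) (E (Y.smul t)) := by
  have h1 : (Y.smul t).conj (E (X.smul s)) = Y.smul t := by
    refine Subtype.ext (hE.trivial_on_centralizer X s _ ?_)
    change ⁅X.1, t • Y.1⁆ = 0
    rw [lie_smul, h, smul_zero]
  have h2 := hE.equivariant (E (X.smul s)) (Y.smul t)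
  rw [h1] at h2
  exact (eq_mul_inv_iff_mul_eq.1 h2).symm

variable (E) in
/-- The point `E(s X₀) E(s ^ p X₁) ⋯ E(s ^ (p ^ (m - 1)) X_{m - 1})` of `H`. -/
def tuplePoint {m : ℕ} (X : Fin m → Nullcone k A p) (s : k) : Points k A :=
  (List.ofFn fun i : Fin m => E ((X i).smul (s ^ p ^ (i : ℕ)))).prod

theorem tuplePoint_succ {m : ℕ} (X : Fin (m + 1) → Nullcone k A p) (s : k) :
    tuplePoint E X s = tuplePoint E (fun i : Fin m => X i.castSucc) s *
      E ((X (Fin.last m)).smul (s ^ p ^ m)) := by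
  simp only [tuplePoint, List.ofFn_succ', List.concat_eq_append, List.prod_append,
    List.prod_singleton, Fin.val_castSucc, Fin.val_last]

theorem commute_tuplePoint_functional (hE : IsExponentialMap E) {m : ℕ}
    {X : Fin m → Nullcone k A p} {Y : lie k A} (h : ∀ i, ⁅(X i).1, Y⁆ = 0) (s : k) :
    Commute (tuplePoint E X s).toFunctional (Y : Functionals k A) := by
  induction m with
  | zero =>
    simp only [tuplePoint, List.ofFn_zero, List.prod_nil, Points.toFunctional_one]
    exact Commute.one_left _
  | succ m ih =>
    rw [tuplePoint_succ, Points.toFunctional_mul]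
    exact (ih fun i => h i.castSucc).mul_left (hE.commute_functional (h _) _)

theorem commute_tuplePoint (hE : IsExponentialMap E) {m : ℕ}
    {X : Fin m → Nullcone k A p} {Y : Nullcone k A p} (h : ∀ i, ⁅(X i).1, Y.1⁆ = 0) (s t : k) :
    Commute (tuplePoint E X s) (E (Y.smul t)) := by
  induction m with
  | zero =>
    simp only [tuplePoint, List.ofFn_zero, List.prod_nil]
    exact Commute.one_left _
  | succ m ih =>
    rw [tuplePoint_succ]
    exact (ih fun i => h i.castSucc).mul_left (hE.commute_points (h _) _ _)

/-! ### Homomorphisms from a Frobenius kernel -/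

variable [CharP k p]

theorem natCast_functionals_eq_zero : (p : Functionals k A) = 0 := by
  rw [← map_natCast (algebraMap k (Functionals k A)), CharP.cast_eq_zero, map_zero]

variable [Fact p.Prime]

/-- The coefficient of `t ^ n` in a homomorphism `𝔾ₐ₍ᵣ₎ → H`, as a functional on `k[H]`. -/
def frobCoeffFunctional {r : ℕ} (Φ : A →ₐc[k] GaFrob k p r) (n : ℕ) : Functionals k A :=
  toConv (frobCoeff k p r n ∘ₗ Φ.toCoalgHom.toLinearMap)

theorem isDividedPowerSeq_frobCoeffFunctional {r : ℕ} (Φ : A →ₐc[k] GaFrob k p r) :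
    IsDividedPowerSeq (frobCoeffFunctional Φ) :=
  (isDividedPowerSeq_frobCoeff p r).comp Φ.toCoalgHom

theorem frobCoeffFunctional_restrict (r : ℕ) (ψ : A →ₐc[k] k[X]) {n : ℕ} (hn : n < p ^ r) :
    frobCoeffFunctional (restrict p r ψ) n = coeffFunctional (ψ : A →ₐ[k] k[X]) n := by
  apply WithConv.ofConv_injective
  ext a
  exact (frobCoeff_mk p r n (ψ a)).trans (if_pos hn)

theorem frobCoeffFunctional_ext {r : ℕ} {Φ Ψ : A →ₐc[k] GaFrob k p r}
    (h : ∀ n < p ^ r, frobCoeffFunctional Φ n = frobCoeffFunctional Ψ n) : Φ = Ψ := by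
  ext a
  exact gaFrob_ext fun n hn => congrArg (fun f : Functionals k A => f a) (h n hn)

variable [Infinite k]

/-! ### The one-parameter subgroup of a commuting tuple -/

/-- Appending `X_m` to a commuting tuple multiplies its one-parameter subgroup by
`s ↦ E(s ^ (p ^ m) X_m)`. This leaves the coefficients below `t ^ (p ^ m)` unchanged and adds `X_m`
to the coefficient of `t ^ (p ^ m)`. -/
theorem exists_isGivenBy_tuplePoint_succ (hE : IsExponentialMap E) {m : ℕ}
    {X : Fin (m + 1) → Nullcone k A p} (hX : ∀ i j, ⁅(X i).1, (X j).1⁆ = 0)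
    {ψ : A →ₐc[k] k[X]} (hψ : IsGivenBy ψ (tuplePoint E fun i : Fin m => X i.castSucc)) :
    ∃ Ψ : A →ₐc[k] k[X], IsGivenBy Ψ (tuplePoint E X) ∧
      (∀ n < p ^ m, coeffFunctional (Ψ : A →ₐ[k] k[X]) n =
        coeffFunctional (ψ : A →ₐ[k] k[X]) n) ∧
      coeffFunctional (Ψ : A →ₐ[k] k[X]) (p ^ m) =
        coeffFunctional (ψ : A →ₐ[k] k[X]) (p ^ m) + ((X (Fin.last m)).1 : Functionals k A) := by
  obtain ⟨φ, hφ, hφ1⟩ := hE.oneParameter (X (Fin.last m))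
  have heval : ∀ s, evalPoint (toConv (ψ : A →ₐ[k] k[X]) *
      toConv ((Polynomial.expand k (p ^ m)).comp (φ : A →ₐ[k] k[X]))).ofConv s =
        tuplePoint E X s := fun s => by
    rw [evalPoint_convMul, evalPoint_expand_comp, tuplePoint_succ, hψ.evalPoint_eq,
      hφ.evalPoint_eq]
  obtain ⟨Ψ, hΨ⟩ := exists_bialgHom_of_evalPoint_add
    (toConv (ψ : A →ₐ[k] k[X]) *
      toConv ((Polynomial.expand k (p ^ m)).comp (φ : A →ₐ[k] k[X]))).ofConv fun s t => by
    rw [evalPoint_convMul, evalPoint_convMul, evalPoint_convMul, evalPoint_expand_comp,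
      evalPoint_expand_comp, evalPoint_expand_comp, add_pow_char_pow, evalPoint_add,
      evalPoint_add]
    refine Commute.mul_mul_mul_comm ?_ _ _
    rw [hψ.evalPoint_eq, hφ.evalPoint_eq]
    exact commute_tuplePoint hE (fun i => hX i.castSucc (Fin.last m)) _ _
  have hψ0 := (isDividedPowerSeq_coeffFunctional ψ).zero
  have hφ0 := (isDividedPowerSeq_coeffFunctional φ).zero
  refine ⟨Ψ, fun s a => ?_, fun n hn => ?_, ?_⟩
  · rw [← heval, ← hΨ]
    exact (evalPoint_apply (Ψ : A →ₐ[k] k[X]) s a).symm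
  · rw [hΨ]
    exact coeffFunctional_mul_expand_of_lt hn _ hφ0
  · rw [hΨ]
    refine (coeffFunctional_mul_expand_self
      (pow_ne_zero _ (Fact.out : p.Prime).ne_zero) hψ0 hφ0).trans ?_
    congr 1
    apply WithConv.ofConv_injective
    ext a
    exact hφ1 a

theorem exists_isGivenBy_tuplePoint (hE : IsExponentialMap E) {m : ℕ}
    {X : Fin m → Nullcone k A p} (hX : ∀ i j, ⁅(X i).1, (X j).1⁆ = 0) :
    ∃ ψ : A →ₐc[k] k[X], IsGivenBy ψ (tuplePoint E X) := by
  induction m with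
  | zero =>
    refine ⟨(Bialgebra.unitBialgHom k k[X]).comp (Bialgebra.counitBialgHom k A), fun s a => ?_⟩
    simp only [tuplePoint, List.ofFn_zero, List.prod_nil]
    exact Polynomial.eval_C
  | succ m ih =>
    obtain ⟨ψ, hψ⟩ := ih fun i j => hX i.castSucc j.castSucc
    obtain ⟨Ψ, hΨ, -⟩ := exists_isGivenBy_tuplePoint_succ hE hX hψ
    exact ⟨Ψ, hΨ⟩

theorem tuple_injective (hE : IsExponentialMap E) {m : ℕ} {X Y : Fin m → Nullcone k A p}
    (hX : ∀ i j, ⁅(X i).1, (X j).1⁆ = 0) (hY : ∀ i j, ⁅(Y i).1, (Y j).1⁆ = 0)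
    {ψ φ : A →ₐc[k] k[X]} (hψ : IsGivenBy ψ (tuplePoint E X)) (hφ : IsGivenBy φ (tuplePoint E Y))
    (h : ∀ n < p ^ m, coeffFunctional (ψ : A →ₐ[k] k[X]) n =
      coeffFunctional (φ : A →ₐ[k] k[X]) n) : X = Y := by
  induction m generalizing ψ φ with
  | zero => exact Subsingleton.elim _ _
  | succ m ih =>
    have hlt : p ^ m < p ^ (m + 1) := Nat.pow_lt_pow_succ (Fact.out : p.Prime).one_lt
    obtain ⟨ψ', hψ'⟩ := exists_isGivenBy_tuplePoint hE fun i j : Fin m => hX i.castSucc j.castSucc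
    obtain ⟨φ', hφ'⟩ := exists_isGivenBy_tuplePoint hE fun i j : Fin m => hY i.castSucc j.castSucc
    obtain ⟨Ψ, hΨ, hΨlt, hΨeq⟩ := exists_isGivenBy_tuplePoint_succ hE hX hψ'
    obtain ⟨Φ, hΦ, hΦlt, hΦeq⟩ := exists_isGivenBy_tuplePoint_succ hE hY hφ'
    obtain rfl := hΨ.unique hψ
    obtain rfl := hΦ.unique hφ
    have hinit : (fun i : Fin m => X i.castSucc) = fun i : Fin m => Y i.castSucc :=
      ih (fun i j => hX i.castSucc j.castSucc) (fun i j => hY i.castSucc j.castSucc) hψ' hφ'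
        fun n hn => by rw [← hΨlt n hn, ← hΦlt n hn, h n (hn.trans hlt)]
    rw [hinit] at hψ'
    obtain rfl := hψ'.unique hφ'
    have hlast : X (Fin.last m) = Y (Fin.last m) := by
      have := h _ hlt
      rw [hΨeq, hΦeq] at this
      exact Subtype.ext (Subtype.ext (add_left_cancel this))
    funext i
    induction i using Fin.lastCases with
    | last => exact hlast
    | cast i => exact congrFun hinit i

/-- An element of `𝔥` that commutes with the coefficients below `t ^ (p ^ m)` of the one-parameter
subgroup of a commuting tuple commutes with the members of the tuple. By induction it commutes with
`X₀, …, X_{i - 1}`, hence with `E(s X₀), …, E(s X_{i - 1})` because these act trivially on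
centralizers; and the coefficient of `t ^ (p ^ i)` is the sum of `X_i` and a functional which
depends on these points only. -/
theorem lie_eq_zero_of_commute_coeffFunctional (hE : IsExponentialMap E) {m : ℕ}
    {X : Fin m → Nullcone k A p} (hX : ∀ i j, ⁅(X i).1, (X j).1⁆ = 0)
    {ψ : A →ₐc[k] k[X]} (hψ : IsGivenBy ψ (tuplePoint E X)) {Y : lie k A}
    (h : ∀ n < p ^ m, Commute (coeffFunctional (ψ : A →ₐ[k] k[X]) n) (Y : Functionals k A))
    (i : Fin m) : ⁅(X i).1, Y⁆ = 0 := by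
  induction m generalizing ψ with
  | zero => exact i.elim0
  | succ m ih =>
    have hlt : p ^ m < p ^ (m + 1) := Nat.pow_lt_pow_succ (Fact.out : p.Prime).one_lt
    obtain ⟨ψ', hψ'⟩ := exists_isGivenBy_tuplePoint hE fun i j : Fin m => hX i.castSucc j.castSucc
    obtain ⟨Ψ, hΨ, hΨlt, hΨeq⟩ := exists_isGivenBy_tuplePoint_succ hE hX hψ'
    obtain rfl := hΨ.unique hψ
    have hinit : ∀ i : Fin m, ⁅(X i.castSucc).1, Y⁆ = 0 :=
      ih (fun i j => hX i.castSucc j.castSucc) hψ' fun n hn => by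
        rw [← hΨlt n hn]
        exact h n (hn.trans hlt)
    induction i using Fin.lastCases with
    | cast i => exact hinit i
    | last =>
      have hcomm : Commute (coeffFunctional (ψ' : A →ₐ[k] k[X]) (p ^ m)) (Y : Functionals k A) :=
        commute_coeffFunctional (fun s => by
          rw [hψ'.evalPoint_eq]
          exact commute_tuplePoint_functional hE hinit s) _
      have hXY := (h _ hlt).sub_left hcomm
      rw [hΨeq, add_sub_cancel_left] at hXY
      exact Subtype.ext (sub_eq_zero.2 hXY)

/-- Every homomorphism `Φ : 𝔾ₐ₍ᵣ₎ → H` agrees below `t ^ (p ^ m)`, for `m ≤ r`, with the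
one-parameter subgroup of a commuting `m`-tuple. Given such a tuple, the next member is the
difference `Z` of the coefficients of `t ^ (p ^ m)`. -/
theorem exists_tuple_coeffFunctional_eq (hE : IsExponentialMap E) {r : ℕ}
    (Φ : A →ₐc[k] GaFrob k p r) {m : ℕ} (hm : m ≤ r) :
    ∃ X : Fin m → Nullcone k A p, (∀ i j, ⁅(X i).1, (X j).1⁆ = 0) ∧
      ∃ ψ : A →ₐc[k] k[X], IsGivenBy ψ (tuplePoint E X) ∧
        ∀ n < p ^ m, frobCoeffFunctional Φ n = coeffFunctional (ψ : A →ₐ[k] k[X]) n := by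
  have hv := isDividedPowerSeq_frobCoeffFunctional Φ
  induction m with
  | zero =>
    obtain ⟨ψ, hψ⟩ := exists_isGivenBy_tuplePoint hE (X := (Fin.elim0 : Fin 0 → Nullcone k A p))
      fun i => i.elim0
    refine ⟨_, fun i => i.elim0, ψ, hψ, fun n hn => ?_⟩
    obtain rfl : n = 0 := by simpa using hn
    rw [hv.zero, (isDividedPowerSeq_coeffFunctional ψ).zero]
  | succ m ih =>
    obtain ⟨X, hX, ψ, hψ, h⟩ := ih (Nat.le_of_succ_le hm)
    have hw := isDividedPowerSeq_coeffFunctional ψ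
    have hlt : p ^ m < p ^ r := Nat.pow_lt_pow_right (Fact.out : p.Prime).one_lt hm
    -- `Z` lies in `𝔥`.
    have hZ : IsPointDerivation
        (frobCoeffFunctional Φ (p ^ m) - coeffFunctional (ψ : A →ₐ[k] k[X]) (p ^ m)) := by
      refine isPointDerivation_sub (pow_ne_zero _ (Fact.out : p.Prime).ne_zero) (fun a b => ?_)
        (fun a b => ?_) hv.zero h
      · refine (congrArg (frobCoeff k p r (p ^ m)) (map_mul Φ a b)).trans ?_
        exact frobCoeff_mul hlt _ _
      · refine (congrArg (fun f : k[X] => f.coeff (p ^ m)) (map_mul ψ a b)).trans ?_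
        exact Polynomial.coeff_mul _ _ _
    let Z : lie k A := ⟨_, hZ⟩
    have hvZ : frobCoeffFunctional Φ (p ^ m) =
        coeffFunctional (ψ : A →ₐ[k] k[X]) (p ^ m) + (Z : Functionals k A) :=
      (add_sub_cancel _ _).symm
    -- `Z` commutes with `X`, and so with the one-parameter subgroup of `X`.
    have hXZ : ∀ i, ⁅(X i).1, Z⁆ = 0 :=
      lie_eq_zero_of_commute_coeffFunctional hE hX hψ fun n hn =>
        Commute.sub_right (by rw [← h n hn]; exact hv.commute _ _) (hw.commute _ _)
    have hwZ : Commute (coeffFunctional (ψ : A →ₐ[k] k[X]) (p ^ m)) (Z : Functionals k A) :=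
      commute_coeffFunctional (fun s => by
        rw [hψ.evalPoint_eq]
        exact commute_tuplePoint_functional hE hXZ s) _
    -- The `p`-th powers of both coefficients vanish, so that of `Z` does.
    have hZp : (Z : Functionals k A) ^ p = 0 := by
      have hadd := add_pow_prime_pow_of_commute p 1 (natCast_functionals_eq_zero (k := k)) hwZ
      rwa [← hvZ, pow_one, hv.pow_prime_eq_zero natCast_functionals_eq_zero,
        hw.pow_prime_eq_zero natCast_functionals_eq_zero, zero_add, eq_comm] at hadd
    let Z' : Nullcone k A p := ⟨Z, hZp⟩
    let X' : Fin (m + 1) → Nullcone k A p := Fin.snoc X Z'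
    have hcast : (fun i : Fin m => X' i.castSucc) = X := funext fun i => Fin.snoc_castSucc ..
    have hlast : X' (Fin.last m) = Z' := Fin.snoc_last ..
    have hX' : ∀ i j, ⁅(X' i).1, (X' j).1⁆ = 0 := by
      intro i j
      induction i using Fin.lastCases with
      | last =>
        induction j using Fin.lastCases with
        | last => exact lie_self _
        | cast j =>
          rw [hlast, congrFun hcast j, ← lie_skew]
          exact neg_eq_zero.2 (hXZ j)
      | cast i =>
        induction j using Fin.lastCases with
        | last =>
          rw [hlast, congrFun hcast i]
          exact hXZ i
        | cast j =>
          rw [congrFun hcast i, congrFun hcast j]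
          exact hX i j
    rw [← hcast] at hψ
    obtain ⟨Ψ, hΨ, hΨlt, hΨeq⟩ := exists_isGivenBy_tuplePoint_succ hE hX' hψ
    refine ⟨X', hX', Ψ, hΨ, fun n hn => ?_⟩
    refine hv.eq_of_lt_pow_succ k (isDividedPowerSeq_coeffFunctional Ψ) (fun n hn => ?_) hn
    rcases hn.lt_or_eq with hn | rfl
    · rw [hΨlt n hn, h n hn]
    · rw [hΨeq, hlast, hvZ]

end Exponential

end ExpGroup

end

open ExpGroup in
theorem mainTheorem1 {k : Type*} [Field k] [IsAlgClosed k] (p : ℕ) [Fact p.Prime] [CharP k p]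
    {A : Type*} [CommRing A] [HopfAlgebra k A] [Algebra.FiniteType k A] [IsReduced A]
    (E : Nullcone k A p → Points k A) (hE : IsExponentialMap E) (r : ℕ) (hr : 1 ≤ r) :
    ∃ Estar : CommTuples k A p r → (A →ₐc[k] GaFrob k p r),
      (∀ X : CommTuples k A p r, ∃ ψ : A →ₐc[k] k[X],
        IsGivenBy ψ (fun s => (List.ofFn fun i : Fin r =>
          E ((X.1 i).smul (s ^ p ^ (i : ℕ)))).prod) ∧
        Estar X = restrict p r ψ) ∧
      Function.Bijective Estar := by
  have : Infinite k := IsAlgClosed.instInfinite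
  choose ψ hψ using fun X : CommTuples k A p r => exists_isGivenBy_tuplePoint hE X.2
  refine ⟨fun X => restrict p r (ψ X), fun X => ⟨ψ X, hψ X, rfl⟩, fun X Y hXY => ?_, fun Φ => ?_⟩
  · refine Subtype.ext (tuple_injective hE X.2 Y.2 (hψ X) (hψ Y) fun n hn => ?_)
    rw [← frobCoeffFunctional_restrict r _ hn, ← frobCoeffFunctional_restrict r _ hn]
    exact congrArg (fun Φ : A →ₐc[k] GaFrob k p r => frobCoeffFunctional Φ n) hXY
  · obtain ⟨X, hX, φ, hφ, h⟩ := exists_tuple_coeffFunctional_eq hE Φ le_rfl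
    refine ⟨⟨X, hX⟩, frobCoeffFunctional_ext fun n hn => ?_⟩
    rw [h n hn, hφ.unique (hψ ⟨X, hX⟩)]
    exact frobCoeffFunctional_restrict r (ψ ⟨X, hX⟩) hn
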